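/- Let $E(q) := \prod_{i=1}^{\infty} (1-q^i) \in \mathbb{Z}[[q]]$. Then for all positive integers $m$ and $n$, every coefficient of the formal power series $$\frac{E(q^{mn})^{mn-m-n}\, E(q^m)\, E(q^n)}{E(q)} \in \mathbb{Z}[[q]]$$ is nonnegative. (The exponent $mn-m-n$ is an integer, possibly negative; the quotient and negative powers make sense because each $E(q^k)$, $k\ge 1$, has constant term $1$ and so is a unit of $\mathbb{Z}[[q]]$.) -/

import Mathlib

open scoped PowerSeries

namespace EtaQuotient

open scoped PowerSeries.WithPiTopology in
/-- Euler's product `E(q) = ∏_{i ≥ 1} (1 - q ^ i)` as a formal power series over `ℤ`. The infinite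
product is taken in the topology of coefficientwise convergence, where it converges
(`multipliable_one_sub_X_pow`). -/
noncomputable def eulerE : ℤ⟦X⟧ :=
  ∏' i : ℕ, (1 - PowerSeries.X ^ (i + 1))

open scoped PowerSeries.WithPiTopology in
theorem multipliable_one_sub_X_pow :
    Multipliable fun i : ℕ => (1 - PowerSeries.X ^ (i + 1) : ℤ⟦X⟧) :=
  PowerSeries.WithPiTopology.multipliable_one_sub_X_pow ℤ

open scoped PowerSeries.WithPiTopology in
theorem constantCoeff_eulerE : PowerSeries.constantCoeff eulerE = 1 := by
  have h := multipliable_one_sub_X_pow.map_tprod (PowerSeries.constantCoeff (R := ℤ))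
    (PowerSeries.WithPiTopology.continuous_constantCoeff ℤ)
  rw [eulerE, h]
  simp

/-- `E(q ^ k)`, obtained from `E(q)` by substituting `q ^ k` for `q`, for `k` positive. -/
noncomputable def eulerEPow (k : ℕ+) : ℤ⟦X⟧ :=
  PowerSeries.expand (k : ℕ) k.ne_zero eulerE

theorem isUnit_eulerEPow (k : ℕ+) : IsUnit (eulerEPow k) := by
  rw [PowerSeries.isUnit_iff_constantCoeff, eulerEPow, PowerSeries.constantCoeff_expand,
    constantCoeff_eulerE]
  exact isUnit_one

/-- `E(q ^ k)` as an element of the unit group of `ℤ⟦q⟧`, so that quotients and integer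
(possibly negative) powers have their usual meaning. -/
noncomputable def E (k : ℕ+) : ℤ⟦X⟧ˣ :=
  (isUnit_eulerEPow k).unit

/-- `F ⪰ 0`: every coefficient of the formal power series `F` is nonnegative. -/
def Nonneg (F : ℤ⟦X⟧) : Prop :=
  ∀ i : ℕ, 0 ≤ PowerSeries.coeff i F

end EtaQuotient

namespace EtaQuotient

open Filter Topology

/-! Put `m = d + 1`, `n = k + 1`, so `mn - m - n = dk - 1`. Splitting `E(q)` and `E(q^m)` into
residue classes modulo `n` turns the quotient into the product over `0 < r < n` of `E(q^{mn})^d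
(q^{mr}; q^{mn})_∞ / (q^r; q^n)_∞` (`etaQuot_mul`).

The factors for `r` and `n - r` are multiplied together. With `p = q^n` and `z = q^r`, the triple
product writes the pair as a ratio of thetas in `z^m` and `z`, which equals the generating function
of `m`-cores (`hasSum_core`) times a theta series of a lattice of rank `d` (`theta_mul_lat`,
`pair_eq_core_mul_lat`). Both are sums of powers of `q` with coefficient one.

For even `n` the factor `r = n/2` is left over; it is the case `n = 2` evaluated at `q^{n/2}`. Since
the quotient is symmetric in `m` and `n`, the same pairing applies there, and the last leftover `m =
n = 2` counts 2-cores.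

Identities are proved for real `0 < q < 1` and carried back to formal series by uniqueness of
coefficients (`nonneg_of_isCounting`). -/

/-- The infinite `q`-Pochhammer symbol `(z; p)_∞` with real arguments. -/
noncomputable def qPoch (z p : ℝ) : ℝ :=
  ∏' k : ℕ, (1 - z * p ^ k)

/-- The finite product `(p; p)_n`. -/
noncomputable def qFact (p : ℝ) (n : ℕ) : ℝ :=
  ∏ i ∈ Finset.range n, (1 - p ^ (i + 1))

/-- The exponent `k (k - 1) / 2`. -/
def tri (k : ℤ) : ℤ := k * (k - 1) / 2

theorem two_mul_tri (k : ℤ) : 2 * tri k = k * (k - 1) :=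
  Int.mul_ediv_cancel' (Int.even_mul_pred_self k).two_dvd

theorem tri_add (a b : ℤ) : tri (a + b) = tri a + tri b + a * b := by
  have h1 := two_mul_tri (a + b)
  have h2 := two_mul_tri a
  have h3 := two_mul_tri b
  linarith

/-- The theta series `∑ z ^ k p ^ (k (k - 1) / 2)` over all integers `k`. -/
noncomputable def theta (z p : ℝ) : ℝ :=
  ∑' k : ℤ, z ^ k * p ^ tri k

/-! ### Convergence of q-products and theta series -/

section

variable {p : ℝ} (hp0 : 0 < p) (hp1 : p < 1)

include hp0 hp1

theorem summable_norm_qPoch (z : ℝ) : Summable fun k : ℕ => ‖-(z * p ^ k)‖ := by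
  have : Summable fun k : ℕ => ‖z‖ * p ^ k :=
    (summable_geometric_of_lt_one hp0.le hp1).mul_left _
  refine this.congr fun k => ?_
  rw [norm_neg, norm_mul, norm_pow, Real.norm_of_nonneg hp0.le]

theorem multipliable_qPoch (z : ℝ) : Multipliable fun k : ℕ => (1 - z * p ^ k) := by
  simpa [sub_eq_add_neg] using multipliable_one_add_of_summable (summable_norm_qPoch hp0 hp1 z)

theorem tendsto_qPoch (z : ℝ) :
    Tendsto (fun N => ∏ k ∈ Finset.range N, (1 - z * p ^ k)) atTop (𝓝 (qPoch z p)) :=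
  (multipliable_qPoch hp0 hp1 z).hasProd.tendsto_prod_nat

theorem qPoch_ne_zero {z : ℝ} (hz : ∀ k : ℕ, z * p ^ k ≠ 1) : qPoch z p ≠ 0 := by
  have := tprod_one_add_ne_zero_of_summable (f := fun k : ℕ => -(z * p ^ k))
    (fun k h => hz k (by linarith)) (summable_norm_qPoch hp0 hp1 z)
  simpa [qPoch, sub_eq_add_neg] using this

theorem qPoch_ne_zero_of_lt {z : ℝ} (hz : z < 1) : qPoch z p ≠ 0 := by
  refine qPoch_ne_zero hp0 hp1 fun k h => ?_
  have h1 : p ^ k ≤ 1 := pow_le_one₀ hp0.le hp1.le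
  have h2 : 0 < p ^ k := pow_pos hp0 k
  nlinarith

theorem tendsto_qFact : Tendsto (qFact p) atTop (𝓝 (qPoch p p)) := by
  refine (tendsto_qPoch hp0 hp1 p).congr fun N => ?_
  simp [qFact, pow_succ']

theorem qFact_pos (n : ℕ) : 0 < qFact p n :=
  Finset.prod_pos fun i _ => sub_pos.2 (pow_lt_one₀ hp0.le hp1 (Nat.succ_ne_zero i))

theorem qFact_le_one (n : ℕ) : qFact p n ≤ 1 :=
  Finset.prod_le_one
    (fun i _ => (sub_pos.2 (pow_lt_one₀ hp0.le hp1 (Nat.succ_ne_zero i))).le)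
    fun _ _ => sub_le_self _ (pow_pos hp0 _).le

theorem qFact_antitone : Antitone (qFact p) :=
  antitone_nat_of_succ_le fun n => by
    rw [qFact, Finset.prod_range_succ]
    exact mul_le_of_le_one_right (qFact_pos hp0 hp1 n).le (sub_le_self _ (pow_pos hp0 _).le)

theorem euler_le_qFact (n : ℕ) : qPoch p p ≤ qFact p n :=
  (qFact_antitone hp0 hp1).le_of_tendsto (tendsto_qFact hp0 hp1) n

theorem euler_ne_zero : qPoch p p ≠ 0 := qPoch_ne_zero_of_lt hp0 hp1 hp1

theorem euler_pos : 0 < qPoch p p :=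
  lt_of_le_of_ne (ge_of_tendsto' (tendsto_qFact hp0 hp1) fun n => (qFact_pos hp0 hp1 n).le)
    (euler_ne_zero hp0 hp1).symm

theorem summable_theta_nat {z : ℝ} (hz : z ≠ 0) :
    Summable fun k : ℕ => z ^ (k : ℤ) * p ^ tri k := by
  refine summable_of_ratio_test_tendsto_lt_one (l := 0) one_pos
    (Eventually.of_forall fun k => mul_ne_zero (zpow_ne_zero _ hz) (zpow_ne_zero _ hp0.ne')) ?_
  have h : Tendsto (fun k : ℕ => ‖z‖ * p ^ k) atTop (𝓝 (‖z‖ * 0)) :=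
    (tendsto_pow_atTop_nhds_zero_of_lt_one hp0.le hp1).const_mul _
  rw [mul_zero] at h
  refine h.congr fun k => ?_
  have h1 : tri ((k + 1 : ℕ) : ℤ) = tri k + k := by
    push_cast
    rw [tri_add]
    simp [tri]
  rw [h1, zpow_add₀ hp0.ne', zpow_natCast, zpow_natCast, zpow_natCast, pow_succ, eq_comm,
    ← norm_div]
  have : z ^ k * z * (p ^ tri k * p ^ k) / (z ^ k * p ^ tri k) = z * p ^ k := by
    have := zpow_ne_zero (tri k) hp0.ne'
    field_simp
  rw [this, norm_mul, norm_pow, Real.norm_of_nonneg hp0.le]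

theorem summable_theta {z : ℝ} (hz : z ≠ 0) : Summable fun k : ℤ => z ^ k * p ^ tri k := by
  refine Summable.of_nat_of_neg (summable_theta_nat hp0 hp1 hz) ?_
  refine (summable_theta_nat hp0 hp1 (z := p / z) (div_ne_zero hp0.ne' hz)).congr fun k => ?_
  have h1 : tri (-k) = tri k + k := by
    have h2 := two_mul_tri (-k)
    have h3 := two_mul_tri k
    linarith
  rw [h1, zpow_add₀ hp0.ne', div_zpow, zpow_neg]
  field_simp

/-! ### The triple product as a limit of the finite binomial theorem -/

/-- Gauss' binomial theorem. -/
theorem prod_one_add_mul_pow (w : ℝ) (M : ℕ) :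
    ∏ k ∈ Finset.range M, (1 + w * p ^ k) = ∑ j ∈ Finset.range (M + 1),
      qFact p M / (qFact p j * qFact p (M - j)) * (w ^ j * p ^ tri j) := by
  induction M generalizing w with
  | zero => simp [qFact, tri]
  | succ M ih =>
    have hf := fun n => (qFact_pos hp0 hp1 n).ne'
    have hs : ∀ n, qFact p (n + 1) = qFact p n * (1 - p ^ (n + 1)) := fun n =>
      Finset.prod_range_succ _ _
    have ht : ∀ j : ℕ, tri ((j + 1 : ℕ) : ℤ) = tri j + j := fun j => by
      push_cast
      rw [tri_add]
      simp [tri]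
    have h0 : qFact p 0 = 1 := by simp [qFact]
    rw [Finset.prod_range_succ, ih, mul_add, mul_one, Finset.sum_mul, Finset.sum_range_succ' _ M,
      Finset.sum_range_succ _ M, Finset.sum_range_succ' _ (M + 1), Finset.sum_range_succ _ M,
      add_add_add_comm, ← Finset.sum_add_distrib, add_assoc]
    congr 1
    swap
    · have h1 := hf M
      have h2 := hf (M + 1)
      rw [ht, zpow_add₀ hp0.ne', add_comm]
      simp only [Nat.sub_self, Nat.sub_zero, h0, zpow_natCast]
      field_simp
      ring
    refine Finset.sum_congr rfl fun j hj => ?_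
    obtain ⟨l, rfl⟩ : ∃ l, M = j + 1 + l := ⟨M - (j + 1), by grind⟩
    have e1 : j + 1 + l - (j + 1) = l := by omega
    have e2 : j + 1 + l - j = l + 1 := by omega
    have e3 : j + 1 + l + 1 - (j + 1) = l + 1 := by omega
    rw [e1, e2, e3, ht, zpow_add₀ hp0.ne', hs (j + 1 + l), hs j, hs l, zpow_natCast]
    have h1 := hf j; have h2 := hf l; have h3 := hf (j + 1); have h4 := hf (l + 1)
    rw [hs] at h3 h4
    have h5 := right_ne_zero_of_mul h3
    have h6 := right_ne_zero_of_mul h4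
    field_simp
    ring

end

section

variable {p : ℝ} (hp0 : 0 < p) (hp1 : p < 1)

include hp0 in
-- The factors are `1 + z p^{-j}` for `1 ≤ j ≤ N`; pulling `z p^{-j}` out of each leaves `1 + (p/z)
-- p^{j-1}`.
theorem prod_one_add_mul_zpow_neg {z : ℝ} (hz : z ≠ 0) (N : ℕ) :
    ∏ k ∈ Finset.range N, (1 + z * p ^ (-(N : ℤ)) * p ^ k) =
      z ^ N * p ^ (-tri (N + 1)) * ∏ k ∈ Finset.range N, (1 - -(p / z) * p ^ k) := by
  induction N with
  | zero => simp [tri]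
  | succ N ih =>
    have h1 : ∀ k : ℕ, z * p ^ (-((N + 1 : ℕ) : ℤ)) * p ^ (k + 1) = z * p ^ (-(N : ℤ)) * p ^ k := by
      intro k
      push_cast
      rw [neg_add, zpow_add₀ hp0.ne', pow_succ]
      field_simp
    have h2 : tri ((N + 1 : ℕ) + 1) = tri (N + 1) + (N + 1 : ℕ) := by
      push_cast
      rw [tri_add (N + 1) 1]
      simp [tri]
    rw [Finset.prod_range_succ', Finset.prod_congr rfl fun k _ => by rw [h1], ih,
      Finset.prod_range_succ, h2, neg_add, zpow_add₀ hp0.ne', zpow_neg p ((N + 1 : ℕ) : ℤ),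
      zpow_natCast]
    generalize ∏ k ∈ Finset.range N, (1 - -(p / z) * p ^ k) = A
    field_simp
    ring

include hp0 hp1

/-- This is Gauss' theorem of length `2N` at `w = z p^{-N}`, with the summation index recentred at
`N`. -/
theorem finite_jacobi {z : ℝ} (hz : z ≠ 0) (N : ℕ) :
    (∏ k ∈ Finset.range N, (1 - -z * p ^ k)) * ∏ k ∈ Finset.range N, (1 - -(p / z) * p ^ k) =
      ∑ k ∈ Finset.Icc (-(N : ℤ)) N, qFact p (2 * N) / (qFact p (N + k).toNat *
        qFact p (N - k).toNat) * (z ^ k * p ^ tri k) := by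
  have h := prod_one_add_mul_pow hp0 hp1 (z * p ^ (-(N : ℤ))) (2 * N)
  rw [two_mul, Finset.prod_range_add, prod_one_add_mul_zpow_neg hp0 hz] at h
  have h1 : ∀ k : ℕ, 1 + z * p ^ (-(N : ℤ)) * p ^ (N + k) = 1 - -z * p ^ k := by
    intro k
    rw [pow_add, zpow_neg, zpow_natCast]
    field_simp
    ring
  simp only [h1] at h
  have h3 : z ^ N * p ^ (-tri (N + 1)) ≠ 0 :=
    mul_ne_zero (pow_ne_zero _ hz) (zpow_ne_zero _ hp0.ne')
  apply mul_left_cancel₀ h3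
  rw [mul_comm (∏ k ∈ Finset.range N, (1 - -z * p ^ k)), ← mul_assoc, h, Finset.mul_sum]
  refine Finset.sum_bij' (fun j _ => (j : ℤ) - N) (fun k _ => (N + k).toNat) ?_ ?_ ?_ ?_ ?_
  · intro j hj; simp at hj ⊢; omega
  · intro j hj; simp at hj ⊢; omega
  · intro j hj; simp
  · intro j hj; simp at hj ⊢; omega
  · intro j hj
    have hj' : j < N + N + 1 := Finset.mem_range.1 hj
    have e1 : ((N : ℤ) + (j - N)).toNat = j := by omega
    have e2 : ((N : ℤ) - (j - N)).toNat = N + N - j := by omega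
    rw [e1, e2, two_mul, mul_left_comm (z ^ N * p ^ (-tri (N + 1)))]
    congr 1
    have e3 : tri j = -tri (N + 1) + tri (j - N) + N * j := by
      have := two_mul_tri j
      have := two_mul_tri (N + 1)
      have := two_mul_tri (j - N)
      linarith
    rw [e3, zpow_add₀ hp0.ne', zpow_add₀ hp0.ne', zpow_sub₀ hz, mul_pow, ← zpow_natCast (_ ^ _),
      ← zpow_mul, zpow_natCast, zpow_natCast, neg_mul, zpow_neg]
    have := zpow_ne_zero (N * j : ℤ) hp0.ne'
    field_simp

/-- **Jacobi triple product identity**. -/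
theorem jacobi_triple {z : ℝ} (hz : z ≠ 0) :
    theta z p = qPoch p p * qPoch (-z) p * qPoch (-(p / z)) p := by
  have hE := euler_pos hp0 hp1
  let f : ℕ → ℤ → ℝ := fun N k => if k ∈ Finset.Icc (-(N : ℤ)) N then
    qFact p (2 * N) / (qFact p (N + k).toNat * qFact p (N - k).toNat) * (z ^ k * p ^ tri k) else 0
  have hlim : Tendsto (fun N => ∑' k, f N k) atTop
      (𝓝 (∑' k : ℤ, (qPoch p p)⁻¹ * (z ^ k * p ^ tri k))) := by
    -- The bounds `(p; p)_∞ ≤ (p; p)_n ≤ 1` dominate the binomial coefficients uniformly in `N`.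
    refine tendsto_tsum_of_dominated_convergence
      (bound := fun k : ℤ => (qPoch p p * qPoch p p)⁻¹ * ‖z ^ k * p ^ tri k‖)
      ((summable_theta hp0 hp1 hz).norm.mul_left _) ?_ ?_
    · intro k
      have h1 : Tendsto (fun N : ℕ => (N + k).toNat) atTop atTop :=
        tendsto_atTop.2 fun b => eventually_atTop.2 ⟨b + k.natAbs, fun N hN => by omega⟩
      have h2 : Tendsto (fun N : ℕ => (N - k).toNat) atTop atTop :=
        tendsto_atTop.2 fun b => eventually_atTop.2 ⟨b + k.natAbs, fun N hN => by omega⟩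
      have h3 : Tendsto (fun N : ℕ => 2 * N) atTop atTop :=
        tendsto_atTop.2 fun b => eventually_atTop.2 ⟨b, fun N hN => by omega⟩
      have hF := tendsto_qFact hp0 hp1
      have := ((hF.comp h3).div ((hF.comp h1).mul (hF.comp h2))
        (mul_ne_zero hE.ne' hE.ne')).mul_const (z ^ k * p ^ tri k)
      rw [div_mul_cancel_left₀ hE.ne'] at this
      refine this.congr' (eventually_atTop.2 ⟨k.natAbs, fun N hN => ?_⟩)
      have hk : k ∈ Finset.Icc (-(N : ℤ)) N := by simp; omega
      simp only [f, if_pos hk]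
      rfl
    · refine Eventually.of_forall fun N k => ?_
      by_cases hk : k ∈ Finset.Icc (-(N : ℤ)) N
      · simp only [f, if_pos hk]
        rw [norm_mul]
        refine mul_le_mul_of_nonneg_right ?_ (norm_nonneg _)
        have h1 := qFact_pos hp0 hp1 (N + k).toNat
        have h2 := qFact_pos hp0 hp1 (N - k).toNat
        rw [Real.norm_of_nonneg (div_nonneg (qFact_pos hp0 hp1 _).le (mul_pos h1 h2).le),
          inv_eq_one_div]
        exact div_le_div₀ zero_le_one (qFact_le_one hp0 hp1 _) (mul_pos hE hE)
          (mul_le_mul (euler_le_qFact hp0 hp1 _) (euler_le_qFact hp0 hp1 _) hE.le h1.le)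
      · simp only [f, if_neg hk, norm_zero]
        positivity
  have hprod := (tendsto_qPoch hp0 hp1 (-z)).mul (tendsto_qPoch hp0 hp1 (-(p / z)))
  have hf : ∀ N, ∑' k, f N k =
      (∏ k ∈ Finset.range N, (1 - -z * p ^ k)) * ∏ k ∈ Finset.range N, (1 - -(p / z) * p ^ k) := by
    intro N
    rw [finite_jacobi hp0 hp1 hz, tsum_eq_sum (s := Finset.Icc (-(N : ℤ)) N)
      fun k hk => by simp only [f, if_neg hk]]
    exact Finset.sum_congr rfl fun k hk => by simp only [f, if_pos hk]
  simp only [hf] at hlim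
  have := tendsto_nhds_unique hlim hprod
  rw [tsum_mul_left] at this
  rw [mul_assoc, ← this, theta, mul_inv_cancel_left₀ hE.ne']

/-- Splitting a `q`-Pochhammer symbol into residue classes. -/
theorem qPoch_eq_prod {m : ℕ} (hm : m ≠ 0) (w : ℝ) :
    qPoch w p = ∏ i ∈ Finset.range m, qPoch (w * p ^ i) (p ^ m) := by
  have h1 := (tendsto_qPoch hp0 hp1 w).comp (tendsto_id.const_mul_atTop' (Nat.pos_of_ne_zero hm))
  have h2 := tendsto_finsetProd (Finset.range m) fun i _ =>
    tendsto_qPoch (pow_pos hp0 m) (pow_lt_one₀ hp0.le hp1 hm) (w * p ^ i)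
  refine tendsto_nhds_unique h1 (h2.congr fun N => ?_)
  rw [Finset.prod_comm]
  simp only [Function.comp, id]
  induction N with
  | zero => simp
  | succ N ih =>
    rw [Finset.prod_range_succ, ih, mul_add, mul_one, Finset.prod_range_add]
    congr 1
    refine Finset.prod_congr rfl fun i _ => ?_
    rw [← pow_mul, pow_add]
    ring

omit hp1 in
/-- Quasi-periodicity of the theta series. -/
theorem theta_mul_zpow {w : ℝ} (hw : w ≠ 0) (i : ℤ) :
    theta (w * p ^ i) p = w ^ (-i) * p ^ (-tri i) * theta w p := by
  rw [theta, theta, ← tsum_mul_left,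
    ← (Equiv.addRight i).tsum_eq (fun k : ℤ => w ^ (-i) * p ^ (-tri i) * (w ^ k * p ^ tri k))]
  refine tsum_congr fun k => ?_
  have h := zpow_ne_zero (tri i) hp0.ne'
  have h' := zpow_ne_zero i hw
  rw [Equiv.coe_addRight, tri_add, mul_zpow, ← zpow_mul, zpow_add₀ hp0.ne', zpow_add₀ hp0.ne',
    zpow_add₀ hw, mul_comm i k, zpow_neg, zpow_neg]
  field_simp

theorem theta_neg_one : theta (-1) p = 0 := by
  rw [jacobi_triple hp0 hp1 (by norm_num), mul_eq_zero, mul_eq_zero]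
  left; right
  exact tprod_of_exists_eq_zero ⟨0, by simp⟩

end

/-! ### The lattice series and its product with a theta series -/

theorem summable_tsum_pi {d : ℕ} (a : Fin d → ℤ → ℝ) (ha : ∀ i, Summable fun k => ‖a i k‖) :
    (Summable fun y : Fin d → ℤ => ‖∏ i, a i (y i)‖) ∧
      ∑' y : Fin d → ℤ, ∏ i, a i (y i) = ∏ i, ∑' k, a i k := by
  induction d with
  | zero => exact ⟨Summable.of_finite, by simp⟩
  | succ d ih =>
    obtain ⟨h1, h2⟩ := ih (fun i => a i.succ) fun i => ha i.succ
    have h3 : ∀ x : ℤ × (Fin d → ℤ), ∏ i, a i (Fin.consEquiv (fun _ => ℤ) x i) =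
        a 0 x.1 * ∏ i : Fin d, a i.succ (x.2 i) := fun x => by
      rw [Fin.prod_univ_succ]; rfl
    constructor
    · rw [← (Fin.consEquiv fun _ => ℤ).summable_iff]
      refine ((ha 0).mul_norm h1).congr fun x => ?_
      rw [Function.comp_apply, h3]
    · rw [← (Fin.consEquiv fun _ => ℤ).tsum_eq, Fin.prod_univ_succ, ← h2,
        tsum_mul_tsum_of_summable_norm (ha 0) h1]
      exact tsum_congr h3

theorem prod_zpow_mul_zpow {d : ℕ} {p : ℝ} (hp : p ≠ 0) (w : Fin d → ℝ) (y : Fin d → ℤ) :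
    ∏ i, (w i ^ y i * p ^ tri (y i)) = (∏ i, w i ^ y i) * p ^ ∑ i, tri (y i) := by
  rw [Finset.prod_mul_distrib]
  congr 1
  induction (Finset.univ : Finset (Fin d)) using Finset.cons_induction with
  | empty => simp
  | cons i s hi ih => rw [Finset.prod_cons, Finset.sum_cons, ih, zpow_add₀ hp]

theorem prod_zpow {d : ℕ} {p : ℝ} (hp : p ≠ 0) (c : Fin d → ℤ) :
    ∏ i, p ^ c i = p ^ ∑ i, c i := by
  induction (Finset.univ : Finset (Fin d)) using Finset.cons_induction with
  | empty => simp
  | cons i s hi ih => rw [Finset.prod_cons, Finset.sum_cons, ih, zpow_add₀ hp]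

theorem two_mul_sum_fin (d : ℕ) : 2 * ∑ i : Fin d, ((i : ℤ) + 1) = d * (d + 1) := by
  induction d with
  | zero => simp
  | succ d ih =>
    rw [Fin.sum_univ_castSucc, mul_add]
    simp only [Fin.val_castSucc, Fin.val_last]
    rw [ih]
    push_cast
    ring

/-- The weight on `ℤ ^ d` whose theta series is a quotient of thetas for `p` and `p ^ (d + 1)`. -/
def latW {d : ℕ} (y : Fin d → ℤ) : ℤ :=
  (d + 1) * ∑ i, tri (y i) + ∑ i : Fin d, ((i : ℤ) + 1) * y i - tri (∑ i, y i)

/-- Cauchy-Schwarz bounds the mixed term `(∑ y)^2` by `d ∑ y^2`, while `2 * latW` contains `(d + 1)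
∑ y^2`. One copy of `∑ y^2` survives, so the lattice series is dominated by a product of
one-dimensional thetas. -/
theorem le_two_mul_latW {d : ℕ} (y : Fin d → ℤ) :
    ∑ i : Fin d, (2 * tri (y i) + (2 * (i : ℤ) + 3 - d) * y i) ≤ 2 * latW y := by
  have h1 := two_mul_tri (∑ i, y i)
  have h2 : (∑ i, y i) ^ 2 ≤ d * ∑ i, y i ^ 2 := by
    simpa using sq_sum_le_card_mul_sum_sq (s := Finset.univ) (f := y)
  have h3 : 2 * ∑ i, tri (y i) = ∑ i, y i ^ 2 - ∑ i, y i := by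
    rw [Finset.mul_sum, ← Finset.sum_sub_distrib]
    exact Finset.sum_congr rfl fun i _ => by rw [two_mul_tri]; ring
  have h4 : ∑ i : Fin d, (2 * tri (y i) + (2 * (i : ℤ) + 3 - d) * y i) =
      2 * ∑ i, tri (y i) + 2 * ∑ i : Fin d, ((i : ℤ) + 1) * y i + (1 - d) * ∑ i, y i := by
    simp only [Finset.mul_sum, ← Finset.sum_add_distrib]
    exact Finset.sum_congr rfl fun i _ => by ring
  rw [h4, latW]
  have h5 : 2 * ((d : ℤ) * ∑ i, tri (y i)) = d * (∑ i, y i ^ 2 - ∑ i, y i) := by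
    rw [← h3]; ring
  linarith

section

variable {p : ℝ} (hp0 : 0 < p) (hp1 : p < 1)

include hp0 hp1

theorem summable_lat (d : ℕ) {z : ℝ} (hz : 0 < z) :
    Summable fun y : Fin d → ℤ => z ^ (-∑ i, y i) * p ^ latW y := by
  -- The lower bound is for twice the weight, hence a square root of `p`.
  obtain ⟨r, hr0, hr⟩ : ∃ r : ℝ, 0 < r ∧ p = r ^ (2 : ℤ) :=
    ⟨√p, Real.sqrt_pos.2 hp0, (by exact_mod_cast (Real.sq_sqrt hp0.le).symm)⟩
  have hr1 : r ≤ 1 := by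
    by_contra h
    push Not at h
    have : 1 < r ^ (2 : ℤ) := one_lt_zpow₀ h (by norm_num)
    linarith
  have h := (summable_tsum_pi
    (fun (i : Fin d) (k : ℤ) => (z⁻¹ * r ^ (2 * (i : ℤ) + 3 - d)) ^ k * p ^ tri k) fun i =>
    (summable_theta hp0 hp1 (mul_pos (inv_pos.2 hz) (zpow_pos hr0 _)).ne').norm).1
  refine h.of_nonneg_of_le (fun y => (mul_pos (zpow_pos hz _) (zpow_pos hp0 _)).le) fun y => ?_
  refine le_trans ?_ (le_abs_self _)
  have h1 : ∀ i : Fin d, (z⁻¹ * r ^ (2 * (i : ℤ) + 3 - d)) ^ y i * p ^ tri (y i) =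
      z ^ (-y i) * r ^ (2 * tri (y i) + (2 * (i : ℤ) + 3 - d) * y i) := by
    intro i
    rw [mul_zpow, zpow_add₀ hr0.ne', zpow_mul, zpow_mul, ← hr, inv_zpow', mul_assoc]
    congr 1
    rw [mul_comm]
  rw [Finset.prod_congr rfl fun i _ => h1 i, Finset.prod_mul_distrib, prod_zpow hz.ne',
    prod_zpow hr0.ne', Finset.sum_neg_distrib]
  refine mul_le_mul_of_nonneg_left ?_ (zpow_pos hz _).le
  rw [hr, ← zpow_mul]
  exact zpow_le_zpow_right_of_le_one₀ hr0 hr1 (le_two_mul_latW y)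

/-- Replacing the theta index by `j + ∑ y` isolates `z^j`. In `tri (j + ∑ y)` the part `tri (∑ y)`
cancels against `latW`, and the cross term `j ∑ y` is linear in `y`, so the sum over `y` factors
into thetas. -/
theorem theta_mul_lat_eq_tsum (d : ℕ) {z : ℝ} (hz : 0 < z) :
    (Summable fun j : ℤ => z ^ j * ((-1) ^ j * p ^ tri j *
        ∏ i : Fin d, theta (-p ^ (j + i + 1)) (p ^ (d + 1)))) ∧
      theta (-z) p * ∑' y : Fin d → ℤ, z ^ (-∑ i, y i) * p ^ latW y =
      ∑' j : ℤ, z ^ j * ((-1) ^ j * p ^ tri j *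
        ∏ i : Fin d, theta (-p ^ (j + i + 1)) (p ^ (d + 1))) := by
  have hP0 : 0 < p ^ (d + 1) := pow_pos hp0 _
  have hP1 : p ^ (d + 1) < 1 := pow_lt_one₀ hp0.le hp1 (by omega)
  have hs1 := (summable_theta hp0 hp1 (neg_ne_zero.2 hz.ne')).norm
  have hs2 := (summable_lat hp0 hp1 d hz).norm
  let e : ℤ × (Fin d → ℤ) ≃ ℤ × (Fin d → ℤ) :=
    { toFun := fun x => (x.1 + ∑ i, x.2 i, x.2)
      invFun := fun x => (x.1 - ∑ i, x.2 i, x.2)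
      left_inv := fun x => by simp
      right_inv := fun x => by simp }
  have hterm : ∀ x : ℤ × (Fin d → ℤ),
      (fun x : ℤ × (Fin d → ℤ) => ((-z) ^ x.1 * p ^ tri x.1) *
        (z ^ (-∑ i, x.2 i) * p ^ latW x.2)) (e x) =
      z ^ x.1 * ((-1) ^ x.1 * p ^ tri x.1 *
        ∏ i : Fin d, ((-p ^ (x.1 + i + 1)) ^ x.2 i * (p ^ (d + 1)) ^ tri (x.2 i))) := by
    rintro ⟨j, y⟩
    simp only [e, Equiv.coe_fn_mk]
    have h1 : ∏ i : Fin d, (-p ^ (j + i + 1)) ^ y i =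
        (-1) ^ (∑ i, y i) * p ^ (∑ i : Fin d, (j + i + 1) * y i) := by
      rw [← prod_zpow (by norm_num), ← prod_zpow hp0.ne', ← Finset.prod_mul_distrib]
      refine Finset.prod_congr rfl fun i _ => ?_
      rw [zpow_mul, ← mul_zpow, neg_one_mul]
    have h2 : tri (j + ∑ i, y i) + latW y =
        tri j + (∑ i : Fin d, (j + i + 1) * y i + (d + 1 : ℕ) * ∑ i, tri (y i)) := by
      have : ∑ i : Fin d, (j + i + 1) * y i =
          j * ∑ i, y i + ∑ i : Fin d, ((i : ℤ) + 1) * y i := by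
        rw [Finset.mul_sum, ← Finset.sum_add_distrib]
        exact Finset.sum_congr rfl fun i _ => by ring
      rw [tri_add, latW, this]
      push_cast
      ring
    rw [prod_zpow_mul_zpow hP0.ne', h1, ← zpow_natCast p (d + 1), ← zpow_mul]
    have h3 : p ^ tri (j + ∑ i, y i) * p ^ latW y = p ^ tri j *
        (p ^ (∑ i : Fin d, (j + i + 1) * y i) * p ^ (((d + 1 : ℕ) : ℤ) * ∑ i, tri (y i))) := by
      rw [← zpow_add₀ hp0.ne', h2, zpow_add₀ hp0.ne', zpow_add₀ hp0.ne']
    rw [← neg_one_mul z, mul_zpow, zpow_add₀ hz.ne', zpow_add₀ (by norm_num : (-1 : ℝ) ≠ 0),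
      zpow_neg]
    have h4 := zpow_ne_zero (∑ i, y i) hz.ne'
    calc _ = (-1) ^ j * (-1) ^ (∑ i, y i) * z ^ j * (p ^ tri (j + ∑ i, y i) * p ^ latW y) := by
          field_simp
      _ = _ := by rw [h3]; ring
  have hsum := (hs1.mul_norm hs2).of_norm
  have hsum' := (e.summable_iff.2 hsum).congr hterm
  have hfib : ∀ j : ℤ, ∑' y : Fin d → ℤ, z ^ j * ((-1) ^ j * p ^ tri j *
        ∏ i : Fin d, ((-p ^ (j + i + 1)) ^ y i * (p ^ (d + 1)) ^ tri (y i))) =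
      z ^ j * ((-1) ^ j * p ^ tri j * ∏ i : Fin d, theta (-p ^ (j + i + 1)) (p ^ (d + 1))) := by
    intro j
    rw [tsum_mul_left, tsum_mul_left, (summable_tsum_pi
      (fun (i : Fin d) (k : ℤ) => (-p ^ (j + i + 1)) ^ k * (p ^ (d + 1)) ^ tri k) fun i =>
      (summable_theta hP0 hP1 (neg_ne_zero.2 (zpow_ne_zero _ hp0.ne'))).norm).2]
    rfl
  constructor
  · exact hsum'.prod.congr hfib
  · rw [theta, tsum_mul_tsum_of_summable_norm hs1 hs2, ← e.tsum_eq, tsum_congr hterm,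
      hsum'.tsum_prod]
    exact tsum_congr hfib

/-- The series of `latW` is a quotient of two theta series, up to a factor independent of `z`. -/
theorem theta_mul_lat (d : ℕ) {z : ℝ} (hz : 0 < z) :
    theta (-z) p * ∑' y : Fin d → ℤ, z ^ (-∑ i, y i) * p ^ latW y =
      (∏ i : Fin d, theta (-p ^ ((i : ℕ) + 1)) (p ^ (d + 1))) *
        theta (-z ^ (d + 1)) (p ^ (d + 1)) := by
  have hP0 : 0 < p ^ (d + 1) := pow_pos hp0 _
  have hP1 : p ^ (d + 1) < 1 := pow_lt_one₀ hp0.le hp1 (by omega)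
  rw [(theta_mul_lat_eq_tsum hp0 hp1 d hz).2]
  -- Only multiples of `d + 1` contribute; there, quasi-periodicity reduces each theta to its value
  -- at `j = 0`.
  let g : ℤ → ℤ := fun i => (d + 1) * i
  have hg : Function.Injective g := mul_right_injective₀ (by omega)
  rw [← hg.tsum_eq, theta, ← tsum_mul_left]
  · refine tsum_congr fun j => ?_
    have h1 : ∀ i : Fin d, theta (-p ^ (g j + i + 1)) (p ^ (d + 1)) =
        (-1) ^ j * (p ^ (-j * ((i : ℤ) + 1)) * (p ^ (d + 1)) ^ (-tri j)) *
          theta (-p ^ ((i : ℕ) + 1)) (p ^ (d + 1)) := by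
      intro i
      have h2 : -p ^ (g j + i + 1) = -p ^ ((i : ℕ) + 1) * (p ^ (d + 1)) ^ j := by
        rw [add_assoc, zpow_add₀ hp0.ne', ← zpow_natCast, ← zpow_natCast p (d + 1), ← zpow_mul]
        simp only [g]
        push_cast
        ring
      rw [h2, theta_mul_zpow hP0 (neg_ne_zero.2 (pow_ne_zero _ hp0.ne')), ← neg_one_mul,
        mul_zpow, ← zpow_natCast p ((i : ℕ) + 1), ← zpow_mul]
      have h5 : ((-1 : ℝ)) ^ (-j) = (-1) ^ j := by
        rw [zpow_neg, ← inv_zpow]; norm_num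
      rw [h5]
      push_cast
      rw [show ((i : ℤ) + 1) * -j = -j * ((i : ℤ) + 1) by ring]
      ring
    have h3 : (∏ i : Fin d, p ^ (-j * ((i : ℤ) + 1)) * (p ^ (d + 1)) ^ (-tri j)) * p ^ tri (g j) =
        (p ^ (d + 1)) ^ tri j := by
      simp only [← zpow_natCast p (d + 1), ← zpow_mul, ← zpow_add₀ hp0.ne']
      rw [prod_zpow hp0.ne', ← zpow_add₀ hp0.ne']
      congr 1
      have h6 := two_mul_tri (g j)
      have h7 := two_mul_tri j
      have h8 := two_mul_sum_fin d
      rw [Finset.sum_add_distrib, ← Finset.mul_sum, Finset.sum_const, Finset.card_univ,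
        Fintype.card_fin, nsmul_eq_mul]
      push_cast
      simp only [g] at h6 ⊢
      apply mul_left_cancel₀ (two_ne_zero (α := ℤ))
      linear_combination h6 - j * h8 - (d + 1) ^ 2 * h7
    have h4 : ((-1 : ℝ) ^ j) * (-1) ^ j = 1 := by
      rw [← mul_zpow]; norm_num
    rw [Finset.prod_congr rfl fun i _ => h1 i, Finset.prod_mul_distrib, Finset.prod_mul_distrib,
      Finset.prod_const, Finset.card_univ, Fintype.card_fin, ← h3, ← neg_one_mul (z ^ (d + 1)),
      mul_zpow, ← zpow_natCast z (d + 1), ← zpow_mul z]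
    have h9 : (-1 : ℝ) ^ g j = ((-1) ^ j) ^ (d + 1) := by
      simp only [g]
      rw [mul_comm, zpow_mul]
      norm_cast
    have h10 : ((-1 : ℝ) ^ j) ^ (d + 1) * ((-1) ^ j) ^ d = (-1) ^ j := by
      rw [pow_succ', mul_assoc, ← mul_pow, h4, one_pow, mul_one]
    rw [h9]
    push_cast
    simp only [g]
    linear_combination (z ^ (((d : ℤ) + 1) * j) * p ^ tri (((d : ℤ) + 1) * j) *
      (∏ i : Fin d, (p ^ (-j * ((i : ℤ) + 1)) * (p ^ (d + 1)) ^ (-tri j))) *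
      ∏ i : Fin d, theta (-p ^ ((i : ℕ) + 1)) (p ^ (d + 1))) * h10
  · intro j hj
    by_contra hne
    apply hj
    have hd : ¬ ((d : ℤ) + 1) ∣ j := fun ⟨i, hi⟩ => hne ⟨i, hi.symm⟩
    -- If `d + 1` does not divide `j`, it divides one of `j + 1, …, j + d`, and the corresponding
    -- theta vanishes by `theta_neg_one`.
    obtain ⟨i, c, hc⟩ : ∃ (i : Fin d) (c : ℤ), j + i + 1 = (d + 1) * c := by
      have h1 := Int.emod_nonneg j (by omega : (d : ℤ) + 1 ≠ 0)
      have h2 := Int.emod_lt_of_pos j (by omega : 0 < (d : ℤ) + 1)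
      have h3 : j % ((d : ℤ) + 1) ≠ 0 := fun h => hd (Int.dvd_of_emod_eq_zero h)
      have h4 := Int.emod_add_mul_ediv j ((d : ℤ) + 1)
      refine ⟨⟨(d - j % ((d : ℤ) + 1)).toNat, by omega⟩, j / ((d : ℤ) + 1) + 1, ?_⟩
      have : (((d - j % ((d : ℤ) + 1)).toNat : ℕ) : ℤ) = d - j % ((d : ℤ) + 1) := by omega
      simp only [this]
      linarith
    have h0 : theta (-p ^ (j + i + 1)) (p ^ (d + 1)) = 0 := by
      have h2 : -p ^ (j + i + 1) = -1 * (p ^ (d + 1)) ^ c := by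
        rw [hc, zpow_mul]
        norm_cast
        simp
      rw [h2, theta_mul_zpow hP0 (by norm_num), theta_neg_one hP0 hP1, mul_zero]
    have h1 : ∏ i : Fin d, theta (-p ^ (j + i + 1)) (p ^ (d + 1)) = 0 :=
      Finset.prod_eq_zero (Finset.mem_univ i) h0
    simp only [h1, mul_zero]

end

/-! ### The generating function of cores -/

/-- The weight on `ℤ ^ (d + 1)` whose restriction to the vectors of sum zero is the size of
`(d + 1)`-core partitions. -/
def coreW {d : ℕ} (x : Fin (d + 1) → ℤ) : ℤ :=
  (d + 1) * ∑ i, tri (x i) + ∑ i : Fin (d + 1), (i : ℤ) * x i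

/-- The rotation `(x_0, …, x_d) ↦ (x_d + 1, x_0, …, x_{d - 1})`. -/
def rotate (d : ℕ) : Equiv.Perm (Fin (d + 1) → ℤ) where
  toFun x := Fin.cons (α := fun _ => ℤ) (x (Fin.last d) + 1) (Fin.init x)
  invFun y := Fin.snoc (α := fun _ => ℤ) (Fin.tail y) (y 0 - 1)
  left_inv x := by simp
  right_inv y := by simp

theorem sum_rotate {d : ℕ} (x : Fin (d + 1) → ℤ) : ∑ i, rotate d x i = ∑ i, x i + 1 := by
  rw [Fin.sum_univ_succ, Fin.sum_univ_castSucc]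
  simp only [rotate, Equiv.coe_fn_mk, Fin.cons_zero, Fin.cons_succ, Fin.init]
  ring

theorem tri_add_one (a : ℤ) : tri (a + 1) = tri a + a := by
  rw [tri_add]; simp [tri]

/-- Moving `x_i` one place up adds `x_i` for `i < d`. The last entry gains `(d + 1) x_d` from `tri`
and loses `d x_d` from the linear term. -/
theorem coreW_rotate {d : ℕ} (x : Fin (d + 1) → ℤ) :
    coreW (rotate d x) = coreW x + ∑ i, x i := by
  rw [coreW, coreW, Fin.sum_univ_succ, Fin.sum_univ_succ, Fin.sum_univ_castSucc,
    Fin.sum_univ_castSucc, Fin.sum_univ_castSucc x]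
  simp only [rotate, Equiv.coe_fn_mk, Fin.cons_zero, Fin.cons_succ, Fin.init, tri_add_one,
    Fin.val_succ, Fin.val_castSucc, Fin.val_last, Fin.val_zero]
  push_cast
  simp only [add_mul, Finset.sum_add_distrib]
  ring_nf

theorem rotate_zpow {d : ℕ} (a : ℤ) : ∀ x : Fin (d + 1) → ℤ,
    ∑ i, (rotate d ^ a) x i = ∑ i, x i + a ∧
      coreW ((rotate d ^ a) x) = coreW x + tri a + a * ∑ i, x i := by
  induction a using Int.induction_on with
  | zero => simp [tri]
  | succ a ih =>
    intro x
    obtain ⟨h1, h2⟩ := ih (rotate d x)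
    rw [zpow_add_one, Equiv.Perm.mul_apply, h1, h2, sum_rotate, coreW_rotate, tri_add_one]
    constructor <;> ring
  | pred a ih =>
    intro x
    obtain ⟨y, rfl⟩ := (rotate d).surjective x
    obtain ⟨h1, h2⟩ := ih y
    have h3 : (rotate d ^ (-(a : ℤ) - 1)) (rotate d y) = (rotate d ^ (-(a : ℤ))) y := by
      rw [← Equiv.Perm.mul_apply, ← zpow_add_one, sub_add_cancel]
    have h4 := tri_add_one (-(a : ℤ) - 1)
    rw [sub_add_cancel] at h4
    rw [h3, h1, h2, sum_rotate, coreW_rotate, h4]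
    constructor <;> ring

/-- Rotating a vector of sum zero in all possible ways. -/
def rotateEquiv (d : ℕ) : ℤ × {x : Fin (d + 1) → ℤ // ∑ i, x i = 0} ≃ (Fin (d + 1) → ℤ) where
  toFun u := (rotate d ^ u.1) u.2.1
  invFun x := (∑ i, x i, ⟨(rotate d ^ (-∑ i, x i)) x, by rw [(rotate_zpow _ x).1]; ring⟩)
  left_inv := by
    rintro ⟨a, x, hx⟩
    have h : ∑ i, (rotate d ^ a) x i = a := by rw [(rotate_zpow a x).1, hx, zero_add]
    refine Prod.ext h (Subtype.ext ?_)
    simp only [h]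
    rw [← Equiv.Perm.mul_apply, ← zpow_add, neg_add_cancel, zpow_zero, Equiv.Perm.one_apply]
  right_inv x := by
    simp only
    rw [← Equiv.Perm.mul_apply, ← zpow_add, add_neg_cancel, zpow_zero, Equiv.Perm.one_apply]

section

variable {p : ℝ} (hp0 : 0 < p) (hp1 : p < 1)

include hp0 hp1

/-- In the triple products, the symbols at `-p^i` reassemble to `(-1; p)_∞` and those at
`-p^{d+1-i}` to `(-p; p)_∞`, which together form `theta 1 p / (p; p)_∞`. -/
theorem prod_theta (d : ℕ) :
    ∏ i : Fin (d + 1), theta (p ^ (i : ℕ)) (p ^ (d + 1)) =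
      qPoch (p ^ (d + 1)) (p ^ (d + 1)) ^ (d + 1) * (theta 1 p / qPoch p p) := by
  have hP0 : 0 < p ^ (d + 1) := pow_pos hp0 _
  have hP1 : p ^ (d + 1) < 1 := pow_lt_one₀ hp0.le hp1 (by omega)
  rw [← Finset.prod_range fun i => theta (p ^ i) (p ^ (d + 1)),
    Finset.prod_congr rfl fun i _ => jacobi_triple hP0 hP1 (pow_ne_zero i hp0.ne'),
    Finset.prod_mul_distrib, Finset.prod_mul_distrib, Finset.prod_const, Finset.card_range,
    mul_assoc, jacobi_triple hp0 hp1 one_ne_zero, mul_assoc (qPoch p p),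
    mul_div_cancel_left₀ _ (euler_ne_zero hp0 hp1), div_one,
    qPoch_eq_prod hp0 hp1 (Nat.succ_ne_zero d) (-1),
    qPoch_eq_prod hp0 hp1 (Nat.succ_ne_zero d) (-p)]
  congr 2
  · exact Finset.prod_congr rfl fun i _ => by rw [neg_one_mul]
  · rw [← Finset.prod_range_reflect]
    refine Finset.prod_congr rfl fun i hi => ?_
    have hi' := Finset.mem_range.1 hi
    congr 1
    rw [neg_mul, ← pow_succ', neg_inj, div_eq_iff (pow_ne_zero _ hp0.ne'), ← pow_add]
    congr 1
    omega

/-- The generating function of `(d + 1)`-cores. -/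
theorem hasSum_core (d : ℕ) :
    HasSum (fun x : {x : Fin (d + 1) → ℤ // ∑ i, x i = 0} => p ^ coreW x.1)
      (qPoch (p ^ (d + 1)) (p ^ (d + 1)) ^ (d + 1) / qPoch p p) := by
  have hP0 : 0 < p ^ (d + 1) := pow_pos hp0 _
  have hP1 : p ^ (d + 1) < 1 := pow_lt_one₀ hp0.le hp1 (by omega)
  obtain ⟨h1, h2⟩ := summable_tsum_pi
    (fun (i : Fin (d + 1)) (k : ℤ) => (p ^ (i : ℕ)) ^ k * (p ^ (d + 1)) ^ tri k) fun i =>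
    (summable_theta hP0 hP1 (pow_ne_zero i hp0.ne')).norm
  have h3 : ∀ x : Fin (d + 1) → ℤ,
      ∏ i : Fin (d + 1), ((p ^ (i : ℕ)) ^ x i * (p ^ (d + 1)) ^ tri (x i)) = p ^ coreW x := by
    intro x
    rw [prod_zpow_mul_zpow hP0.ne', coreW, zpow_add₀ hp0.ne', mul_comm, ← zpow_natCast,
      ← zpow_mul, ← prod_zpow hp0.ne']
    push_cast
    congr 1
    exact Finset.prod_congr rfl fun i _ => by rw [← zpow_natCast, ← zpow_mul]
  simp only [h3] at h1 h2
  have hs := (rotateEquiv d).summable_iff.2 h1.of_norm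
  have h4 : ∀ u, ((fun x => p ^ coreW x) ∘ rotateEquiv d) u = p ^ tri u.1 * p ^ coreW u.2.1 := by
    rintro ⟨a, x, hx⟩
    simp only [Function.comp, rotateEquiv, Equiv.coe_fn_mk]
    rw [(rotate_zpow a x).2, hx, mul_zero, add_zero, zpow_add₀ hp0.ne', mul_comm]
  have hs' := hs.congr h4
  have hcore : Summable fun x : {x : Fin (d + 1) → ℤ // ∑ i, x i = 0} => p ^ coreW x.1 := by
    have := hs'.prod_factor 0
    simpa [tri] using this
  have hth := summable_theta hp0 hp1 one_ne_zero
  simp only [one_zpow, one_mul] at hth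
  -- On a vector of sum zero, `a` rotations add exactly `tri a`, so the full lattice sum factors
  -- over `rotateEquiv`.
  have h5 : theta 1 p * ∑' x : {x : Fin (d + 1) → ℤ // ∑ i, x i = 0}, p ^ coreW x.1 =
      ∑' x : Fin (d + 1) → ℤ, p ^ coreW x := by
    rw [← (rotateEquiv d).tsum_eq, (tsum_congr h4 : ∑' u, p ^ coreW (rotateEquiv d u) = _),
      hs'.tsum_prod]
    simp only [tsum_mul_left, tsum_mul_right, theta, one_zpow, one_mul]
  have h6 : theta 1 p ≠ 0 := by
    have : 0 < theta 1 p := by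
      simp only [theta, one_zpow, one_mul]
      exact hth.tsum_pos (fun k => (zpow_pos hp0 _).le) 0 (zpow_pos hp0 _)
    exact this.ne'
  rw [h2] at h5
  have h7 : ∏ i : Fin (d + 1), ∑' k : ℤ, (p ^ (i : ℕ)) ^ k * (p ^ (d + 1)) ^ tri k =
    ∏ i : Fin (d + 1), theta (p ^ (i : ℕ)) (p ^ (d + 1)) := rfl
  rw [h7, prod_theta hp0 hp1, mul_div_left_comm] at h5
  rw [← mul_left_cancel₀ h6 h5]
  exact hcore.hasSum

/-! ### A pair of opposite residues as a core series times a lattice series -/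

/-- Both nontrivial factors of the triple products run over the nonzero residues modulo `d + 1`,
each giving `E(p) / E(p^{d+1})`. -/
theorem prod_theta_neg (d : ℕ) :
    (∏ i : Fin d, theta (-p ^ ((i : ℕ) + 1)) (p ^ (d + 1))) *
        qPoch (p ^ (d + 1)) (p ^ (d + 1)) ^ 2 =
      qPoch (p ^ (d + 1)) (p ^ (d + 1)) ^ d * qPoch p p ^ 2 := by
  have hP0 : 0 < p ^ (d + 1) := pow_pos hp0 _
  have hP1 : p ^ (d + 1) < 1 := pow_lt_one₀ hp0.le hp1 (by omega)
  have h1 : qPoch p p = (∏ i ∈ Finset.range d, qPoch (p ^ (i + 1)) (p ^ (d + 1))) *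
      qPoch (p ^ (d + 1)) (p ^ (d + 1)) := by
    rw [qPoch_eq_prod hp0 hp1 (Nat.succ_ne_zero d), Finset.prod_range_succ]
    simp only [← pow_succ']
  have h2 : ∏ i ∈ Finset.range d, qPoch (-(p ^ (d + 1) / -p ^ (i + 1))) (p ^ (d + 1)) =
      ∏ i ∈ Finset.range d, qPoch (p ^ (i + 1)) (p ^ (d + 1)) := by
    rw [← Finset.prod_range_reflect]
    refine Finset.prod_congr rfl fun i hi => ?_
    have hi' := Finset.mem_range.1 hi
    congr 1
    rw [div_neg, neg_neg, div_eq_iff (pow_ne_zero _ hp0.ne'), ← pow_add]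
    congr 1
    omega
  rw [← Finset.prod_range fun i => theta (-p ^ (i + 1)) (p ^ (d + 1)),
    Finset.prod_congr rfl fun i _ =>
      jacobi_triple hP0 hP1 (neg_ne_zero.2 (pow_ne_zero (i + 1) hp0.ne')),
    Finset.prod_mul_distrib, Finset.prod_mul_distrib, Finset.prod_const, Finset.card_range, h2, h1]
  simp only [neg_neg]
  ring

/-- The triple product applied to both sides of `theta_mul_lat`. The range of `z` keeps both `(z;
p)_∞` and `(p/z; p)_∞` nonzero. -/
theorem pair_eq_core_mul_lat (d : ℕ) {z : ℝ} (hz0 : p < z) (hz1 : z < 1) :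
    (qPoch (p ^ (d + 1)) (p ^ (d + 1)) ^ d * qPoch (z ^ (d + 1)) (p ^ (d + 1)) / qPoch z p) *
      (qPoch (p ^ (d + 1)) (p ^ (d + 1)) ^ d * qPoch ((p / z) ^ (d + 1)) (p ^ (d + 1)) /
        qPoch (p / z) p) =
    (qPoch (p ^ (d + 1)) (p ^ (d + 1)) ^ (d + 1) / qPoch p p) *
      ∑' y : Fin d → ℤ, z ^ (-∑ i, y i) * p ^ latW y := by
  have hP0 : 0 < p ^ (d + 1) := pow_pos hp0 _
  have hP1 : p ^ (d + 1) < 1 := pow_lt_one₀ hp0.le hp1 (by omega)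
  have hz : 0 < z := hp0.trans hz0
  have h1 := theta_mul_lat hp0 hp1 d hz
  have h2 := prod_theta_neg hp0 hp1 d
  rw [jacobi_triple hp0 hp1 (neg_ne_zero.2 hz.ne'),
    jacobi_triple hP0 hP1 (neg_ne_zero.2 (pow_ne_zero (d + 1) hz.ne'))] at h1
  simp only [div_neg, neg_neg] at h1
  have e1 := euler_ne_zero hp0 hp1
  have e2 := euler_ne_zero hP0 hP1
  have e3 := qPoch_ne_zero_of_lt hp0 hp1 hz1
  have e4 := qPoch_ne_zero_of_lt hp0 hp1 ((div_lt_one hz).2 hz0)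
  rw [div_pow]
  set L := ∑' y : Fin d → ℤ, z ^ (-∑ i, y i) * p ^ latW y
  set A := qPoch (p ^ (d + 1)) (p ^ (d + 1))
  set T := ∏ i : Fin d, theta (-p ^ ((i : ℕ) + 1)) (p ^ (d + 1))
  rw [div_mul_div_comm, div_mul_eq_mul_div, div_eq_div_iff (mul_ne_zero e3 e4) e1]
  apply mul_left_cancel₀ (mul_ne_zero e1 e2)
  linear_combination (-A ^ (d + 2)) * h1 - (A ^ (d + 1) * qPoch (z ^ (d + 1)) (p ^ (d + 1)) *
    qPoch (p ^ (d + 1) / z ^ (d + 1)) (p ^ (d + 1))) * h2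

end

/-! ### From functions on (0, 1) to formal power series -/

/-- `g` is a generating function `∑ q ^ e(i)` of a family of integers, for `0 < q < 1`. -/
def IsCounting (g : ℝ → ℝ) : Prop :=
  ∃ (I : Type) (e : I → ℤ), ∀ q : ℝ, 0 < q → q < 1 → HasSum (fun i => q ^ e i) (g q)

/-- `g` is the sum of the power series `f` on the interval `(0, 1)`. -/
def IsEval (f : ℤ⟦X⟧) (g : ℝ → ℝ) : Prop :=
  ∀ q : ℝ, 0 < q → q < 1 → HasSum (fun k : ℕ => ((PowerSeries.coeff k f : ℤ) : ℝ) * q ^ k) (g q)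

theorem IsCounting.congr {g h : ℝ → ℝ} (hg : IsCounting g)
    (hgh : ∀ q : ℝ, 0 < q → q < 1 → h q = g q) : IsCounting h := by
  obtain ⟨I, e, he⟩ := hg
  exact ⟨I, e, fun q h0 h1 => hgh q h0 h1 ▸ he q h0 h1⟩

theorem IsCounting.one : IsCounting fun _ => 1 :=
  ⟨Unit, fun _ => 0, fun q _ _ => by simp⟩

theorem IsCounting.mul {g h : ℝ → ℝ} (hg : IsCounting g) (hh : IsCounting h) :
    IsCounting fun q => g q * h q := by
  obtain ⟨I, e, he⟩ := hg
  obtain ⟨J, f, hf⟩ := hh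
  refine ⟨I × J, fun x => e x.1 + f x.2, fun q h0 h1 => ?_⟩
  have hs := (he q h0 h1).summable.mul_of_nonneg (hf q h0 h1).summable
    (fun _ => (zpow_pos h0 _).le) fun _ => (zpow_pos h0 _).le
  refine ((he q h0 h1).mul (hf q h0 h1) hs).congr_fun fun x => ?_
  rw [zpow_add₀ h0.ne']

theorem IsCounting.prod {ι : Type*} (s : Finset ι) (g : ι → ℝ → ℝ)
    (hg : ∀ i ∈ s, IsCounting (g i)) : IsCounting fun q => ∏ i ∈ s, g i q := by
  induction s using Finset.cons_induction with
  | empty => simpa using IsCounting.one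
  | cons i s hi ih =>
    simp only [Finset.prod_cons]
    exact (hg i (by simp)).mul (ih fun j hj => hg j (by simp [hj]))

theorem IsCounting.comp_pow {g : ℝ → ℝ} (hg : IsCounting g) {n : ℕ} (hn : n ≠ 0) :
    IsCounting fun q => g (q ^ n) := by
  obtain ⟨I, e, he⟩ := hg
  refine ⟨I, fun i => n * e i, fun q h0 h1 => ?_⟩
  refine (he (q ^ n) (pow_pos h0 n) (pow_lt_one₀ h0.le h1 hn)).congr_fun fun i => ?_
  rw [zpow_mul, zpow_natCast]

theorem IsEval.mul {f f' : ℤ⟦X⟧} {g g' : ℝ → ℝ} (h : IsEval f g) (h' : IsEval f' g') :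
    IsEval (f * f') fun q => g q * g' q := by
  intro q h0 h1
  have hs := (h q h0 h1).summable.norm
  have hs' := (h' q h0 h1).summable.norm
  beta_reduce
  rw [← (h q h0 h1).tsum_eq, ← (h' q h0 h1).tsum_eq,
    tsum_mul_tsum_eq_tsum_sum_antidiagonal_of_summable_norm hs hs']
  have := (summable_norm_sum_mul_antidiagonal_of_summable_norm hs hs').of_norm.hasSum
  refine this.congr_fun fun n => ?_
  rw [PowerSeries.coeff_mul, Int.cast_sum, Finset.sum_mul]
  refine Finset.sum_congr rfl fun x hx => ?_
  rw [← Finset.HasAntidiagonal.mem_antidiagonal.1 hx, pow_add]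
  push_cast
  ring

theorem IsEval.one : IsEval 1 fun _ => 1 := by
  intro q _ _
  simpa using hasSum_single (f := fun k : ℕ => ((PowerSeries.coeff k (1 : ℤ⟦X⟧) : ℤ) : ℝ) * q ^ k) 0
    fun k hk => by simp [PowerSeries.coeff_one, hk]

theorem IsEval.pow {f : ℤ⟦X⟧} {g : ℝ → ℝ} (h : IsEval f g) (n : ℕ) :
    IsEval (f ^ n) fun q => g q ^ n := by
  induction n with
  | zero => simpa using IsEval.one
  | succ n ih => simpa only [pow_succ] using ih.mul h

theorem IsEval.X_pow (n : ℕ) : IsEval (PowerSeries.X ^ n) fun q => q ^ n := by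
  intro q _ _
  convert hasSum_single (f := fun k : ℕ =>
    ((PowerSeries.coeff k (PowerSeries.X ^ n : ℤ⟦X⟧) : ℤ) : ℝ) * q ^ k) n
    fun k hk => by simp [PowerSeries.coeff_X_pow, hk] using 1
  simp

theorem IsEval.expand {f : ℤ⟦X⟧} {g : ℝ → ℝ} (h : IsEval f g) {n : ℕ} (hn : n ≠ 0) :
    IsEval (PowerSeries.expand n hn f) fun q => g (q ^ n) := by
  intro q h0 h1
  have h2 := h (q ^ n) (pow_pos h0 n) (pow_lt_one₀ h0.le h1 hn)
  rw [← (mul_right_injective₀ hn).hasSum_iff]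
  · refine h2.congr_fun fun k => ?_
    simp [PowerSeries.coeff_expand, hn, pow_mul]
  · intro k hk
    have : ¬ n ∣ k := fun ⟨j, hj⟩ => hk ⟨j, hj.symm⟩
    simp [PowerSeries.coeff_expand, this]

/-- Once the coefficients below `n` vanish, dividing by `q^n` and letting `q` tend to `0` from the
right isolates the `n`-th; the series at `1/2` dominates. -/
theorem IsEval.eq_zero {f : ℤ⟦X⟧} (h : IsEval f fun _ => 0) : f = 0 := by
  ext n
  rw [map_zero]
  induction n using Nat.strong_induction_on with
  | _ n ih =>
  set c : ℕ → ℝ := fun k => ((PowerSeries.coeff k f : ℤ) : ℝ) with hc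
  have h1 : ∀ q : ℝ, 0 < q → q < 1 → HasSum (fun k => c (k + n) * q ^ k) 0 := by
    intro q h0 h1
    have h2 := (hasSum_nat_add_iff' n).2 (h q h0 h1)
    rw [Finset.sum_eq_zero fun i hi => by rw [ih i (Finset.mem_range.1 hi)]; simp] at h2
    have h3 := h2.mul_left ((q ^ n)⁻¹)
    rw [sub_zero, mul_zero] at h3
    refine h3.congr_fun fun k => ?_
    simp only [hc]
    rw [pow_add]
    field_simp
  have hlim : Tendsto (fun q : ℝ => ∑' k, c (k + n) * q ^ k) (𝓝[>] 0)
      (𝓝 (∑' k, c (k + n) * 0 ^ k)) := by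
    refine tendsto_tsum_of_dominated_convergence (bound := fun k => ‖c (k + n) * (1 / 2) ^ k‖)
      (h1 (1 / 2) (by norm_num) (by norm_num)).summable.norm ?_ ?_
    · intro k
      exact ((continuous_const.mul (continuous_pow k)).tendsto 0).mono_left nhdsWithin_le_nhds
    · filter_upwards [Ioo_mem_nhdsGT (show (0 : ℝ) < 1 / 2 by norm_num)] with q hq k
      rw [norm_mul, norm_mul, norm_pow, norm_pow, Real.norm_of_nonneg hq.1.le,
        Real.norm_of_nonneg (by norm_num : (0 : ℝ) ≤ 1 / 2)]
      exact mul_le_mul_of_nonneg_left (pow_le_pow_left₀ hq.1.le hq.2.le k) (norm_nonneg _)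
  have hlim0 : Tendsto (fun q : ℝ => ∑' k, c (k + n) * q ^ k) (𝓝[>] 0) (𝓝 0) := by
    refine tendsto_const_nhds.congr' ?_
    filter_upwards [Ioo_mem_nhdsGT (zero_lt_one (α := ℝ))] with q hq
    exact (h1 q hq.1 hq.2).tsum_eq.symm
  have h4 := tendsto_nhds_unique hlim hlim0
  rw [tsum_eq_single 0 fun k hk => by simp [hk]] at h4
  simpa [hc] using h4

theorem IsEval.unique {f f' : ℤ⟦X⟧} {g : ℝ → ℝ} (h : IsEval f g) (h' : IsEval f' g) : f = f' := by
  refine sub_eq_zero.1 (IsEval.eq_zero fun q h0 h1 => ?_)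
  have := (h q h0 h1).sub (h' q h0 h1)
  rw [sub_self] at this
  refine this.congr_fun fun k => ?_
  rw [map_sub]
  push_cast
  ring

/-- A counting function is, up to a monomial, the sum of a power series with nonnegative
coefficients. -/
theorem IsCounting.exists_isEval {g : ℝ → ℝ} (hg : IsCounting g) :
    ∃ (N : ℤ⟦X⟧) (M : ℕ), Nonneg N ∧ IsEval N fun q => q ^ M * g q := by
  obtain ⟨I, e, he⟩ := hg
  -- Convergence at `q = 1/2` alone makes the fibres of `e` finite and its values bounded below.
  have hfin : ∀ n : ℤ, {i | e i ≤ n}.Finite := by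
    intro n
    have h1 := (he (1 / 2) (by norm_num) (by norm_num)).summable.tendsto_cofinite_zero
    have h2 : ∀ᶠ i in cofinite, (1 / 2 : ℝ) ^ e i < (1 / 2) ^ n :=
      h1.eventually_lt_const (zpow_pos (by norm_num) n)
    refine (eventually_cofinite.1 h2).subset fun i hi => ?_
    simp only [Set.mem_ofPred_eq, not_lt] at hi ⊢
    exact zpow_le_zpow_right_of_le_one₀ (by norm_num) (by norm_num) hi
  obtain ⟨b, hb⟩ := ((hfin 0).image e).bddBelow
  have hM : ∀ i, 0 ≤ e i + (b.natAbs : ℤ) := by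
    intro i
    by_cases hi : e i ≤ 0
    · have : b ≤ e i := hb ⟨i, hi, rfl⟩
      omega
    · omega
  set M := b.natAbs
  let f : I → ℕ := fun i => (e i + M).toNat
  have hf : ∀ i, (f i : ℤ) = e i + M := fun i => Int.toNat_of_nonneg (hM i)
  have hff : ∀ k : ℕ, Finite {i // f i = k} := fun k =>
    ((hfin k).subset fun i (hi : f i = k) => by
      have := hf i
      simp only [Set.mem_ofPred_eq]
      omega).to_subtype
  refine ⟨PowerSeries.mk fun k => (Nat.card {i // f i = k} : ℤ), M, fun k => by simp, ?_⟩
  intro q h0 h1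
  have h2 := (he q h0 h1).mul_left (q ^ M)
  have h3 : ∀ i, q ^ M * q ^ e i = q ^ f i := fun i => by
    rw [← zpow_natCast q (f i), hf, zpow_add₀ h0.ne', mul_comm, zpow_natCast]
  simp only [h3] at h2
  rw [← (Equiv.sigmaFiberEquiv f).hasSum_iff] at h2
  refine h2.sigma fun k => ?_
  have := Fintype.ofFinite {i // f i = k}
  have h4 : (fun c : {i // f i = k} => ((fun i => q ^ f i) ∘ Equiv.sigmaFiberEquiv f) ⟨k, c⟩) =
      fun _ => q ^ k := by
    ext ⟨i, hi⟩
    simp [hi]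
  rw [h4]
  have h5 := hasSum_fintype fun _ : {i // f i = k} => q ^ k
  simpa [PowerSeries.coeff_mk, Nat.card_eq_fintype_card] using h5

/-- Exponents of a counting function may be negative, so the comparison gives `X^M * K` with
nonnegative coefficients; these are the coefficients of `K` shifted by `M`. -/
theorem nonneg_of_isCounting {g δ υ : ℝ → ℝ} {D U K : ℤ⟦X⟧} (hg : IsCounting g) (hD : IsEval D δ)
    (hU : IsEval U υ) (h : ∀ q : ℝ, 0 < q → q < 1 → g q * δ q = υ q) (hK : K * D = U)
    (hD0 : D ≠ 0) : Nonneg K := by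
  obtain ⟨N, M, hN, hev⟩ := hg.exists_isEval
  have h1 := hev.mul hD
  have h2 : IsEval (PowerSeries.X ^ M * U) fun q => q ^ M * g q * δ q := by
    intro q h0 h1
    have := (IsEval.X_pow M).mul hU q h0 h1
    beta_reduce at this
    rwa [← h q h0 h1, ← mul_assoc] at this
  have h3 := h1.unique h2
  rw [← hK, ← mul_assoc] at h3
  have h4 := mul_right_cancel₀ hD0 h3
  intro k
  have := hN (k + M)
  rwa [h4, mul_comm, PowerSeries.coeff_mul_X_pow] at this

/-- The formal product is the pentagonal series, which sums to `theta (-q) (q ^ 3)`; the triple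
product turns this into the three residue classes modulo 3 of `(q; q)_∞`. -/
theorem isEval_eulerE : IsEval eulerE fun q => qPoch q q := by
  intro q h0 h1
  have hP0 : 0 < q ^ 3 := pow_pos h0 _
  have hP1 : q ^ 3 < 1 := pow_lt_one₀ h0.le h1 (by omega)
  have hE : eulerE = PowerSeries.pentagonalSeries ℤ :=
    PowerSeries.WithPiTopology.tprod_one_sub_X_pow ℤ
  have h2 : qPoch q q = theta (-q) (q ^ 3) := by
    rw [jacobi_triple hP0 hP1 (neg_ne_zero.2 h0.ne'), qPoch_eq_prod h0 h1 three_ne_zero,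
      Finset.prod_range_succ, Finset.prod_range_succ, Finset.prod_range_one,
      show -(q ^ 3 / -q) = q * q ^ 1 by field_simp, show q * q ^ 2 = q ^ 3 by ring]
    simp only [pow_zero, mul_one, neg_neg]
    ring
  beta_reduce
  rw [hE, h2, ← pentagonal_injective.hasSum_iff]
  · refine (summable_theta hP0 hP1 (neg_ne_zero.2 h0.ne')).hasSum.congr_fun fun k => ?_
    have h3 : (pentagonal k : ℤ) = k + 3 * tri k := by
      have h4 := two_mul_natCast_pentagonal k
      have h5 := two_mul_tri k
      linarith
    rw [Function.comp_apply, PowerSeries.coeff_pentagonalSeries_pentagonal,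
      ← zpow_natCast q (pentagonal k), h3,
      zpow_add₀ h0.ne', zpow_mul, ← neg_one_mul q, mul_zpow]
    norm_cast
    rw [mul_assoc]
    congr 1
    rcases Int.even_or_odd k with hk | hk
    · simp [hk.neg_one_zpow, (Int.natAbs_even.2 hk).neg_one_pow]
    · simp [hk.neg_one_zpow, (Int.natAbs_odd.2 hk).neg_one_pow]
  · intro k hk
    rw [PowerSeries.coeff_pentagonalSeries_eq_zero ℤ hk]
    simp

/-! ### Pairing the residues -/

/-- A factor of the eta quotient with parameters `d + 1` and `n`, attached to the residue `r`
modulo `n`. -/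
noncomputable def etaFactor (d n r : ℕ) (q : ℝ) : ℝ :=
  qPoch (q ^ ((d + 1) * n)) (q ^ ((d + 1) * n)) ^ d *
    qPoch (q ^ ((d + 1) * r)) (q ^ ((d + 1) * n)) / qPoch (q ^ r) (q ^ n)

/-- The eta quotient with parameters `d + 1` and `k + 1`, as a function on `(0, 1)`. -/
noncomputable def etaQuot (d k : ℕ) (q : ℝ) : ℝ :=
  ∏ r ∈ Finset.range k, etaFactor d (k + 1) (r + 1) q

section

variable {q : ℝ} (h0 : 0 < q) (h1 : q < 1)

include h0 h1

theorem euler_pow_ne_zero {n : ℕ} (hn : n ≠ 0) : qPoch (q ^ n) (q ^ n) ≠ 0 :=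
  euler_ne_zero (pow_pos h0 n) (pow_lt_one₀ h0.le h1 hn)

theorem euler_eq_prod_mul (k : ℕ) :
    qPoch q q = (∏ r ∈ Finset.range k, qPoch (q ^ (r + 1)) (q ^ (k + 1))) *
      qPoch (q ^ (k + 1)) (q ^ (k + 1)) := by
  rw [qPoch_eq_prod h0 h1 (Nat.succ_ne_zero k), Finset.prod_range_succ]
  simp only [← pow_succ']

theorem etaQuot_mul (d k : ℕ) :
    etaQuot d k q * (qPoch q q * qPoch (q ^ ((d + 1) * (k + 1))) (q ^ ((d + 1) * (k + 1)))) =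
      qPoch (q ^ ((d + 1) * (k + 1))) (q ^ ((d + 1) * (k + 1))) ^ (d * k) *
        qPoch (q ^ (d + 1)) (q ^ (d + 1)) * qPoch (q ^ (k + 1)) (q ^ (k + 1)) := by
  have h2 := euler_eq_prod_mul (pow_pos h0 (d + 1)) (pow_lt_one₀ h0.le h1 (Nat.succ_ne_zero d)) k
  simp only [← pow_mul] at h2
  have h3 : ∏ r ∈ Finset.range k, qPoch (q ^ (r + 1)) (q ^ (k + 1)) ≠ 0 :=
    Finset.prod_ne_zero_iff.2 fun r _ => qPoch_ne_zero_of_lt (pow_pos h0 _)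
      (pow_lt_one₀ h0.le h1 (Nat.succ_ne_zero k)) (pow_lt_one₀ h0.le h1 (Nat.succ_ne_zero r))
  rw [h2, euler_eq_prod_mul h0 h1 k, etaQuot]
  simp only [etaFactor]
  rw [Finset.prod_div_distrib, Finset.prod_mul_distrib, Finset.prod_const, Finset.card_range,
    ← pow_mul]
  field_simp

/-- The product over residues hides the symmetry, but the other terms of `etaQuot_mul` are symmetric
in `d` and `k`. -/
theorem etaQuot_comm (d k : ℕ) : etaQuot d k q = etaQuot k d q := by
  have h2 := etaQuot_mul h0 h1 d k
  have h3 := etaQuot_mul h0 h1 k d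
  rw [mul_comm (k + 1) (d + 1), mul_comm k d, mul_right_comm, ← h2] at h3
  exact (mul_right_cancel₀ (mul_ne_zero (euler_ne_zero h0 h1)
    (euler_pow_ne_zero h0 h1 (by positivity))) h3).symm

end

theorem isCounting_core (d : ℕ) :
    IsCounting fun p => qPoch (p ^ (d + 1)) (p ^ (d + 1)) ^ (d + 1) / qPoch p p :=
  ⟨_, _, fun _ h0 h1 => hasSum_core h0 h1 d⟩

theorem isCounting_lat (d n r : ℕ) (hn : n ≠ 0) :
    IsCounting fun q => ∑' y : Fin d → ℤ, (q ^ r) ^ (-∑ i, y i) * (q ^ n) ^ latW y := by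
  refine ⟨Fin d → ℤ, fun y => r * (-∑ i, y i) + n * latW y, fun q h0 h1 => ?_⟩
  refine (summable_lat (pow_pos h0 n) (pow_lt_one₀ h0.le h1 hn) d
    (pow_pos h0 r)).hasSum.congr_fun fun y => ?_
  rw [zpow_add₀ h0.ne', zpow_mul, zpow_mul, zpow_natCast, zpow_natCast]

/-- Here `p = q^n` and `z = q^r`, so that `p / z = q^s`. -/
theorem isCounting_pair (d : ℕ) {n r s : ℕ} (hrs : r + s = n) (hr : r ≠ 0) (hs : s ≠ 0) :
    IsCounting fun q => etaFactor d n r q * etaFactor d n s q := by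
  have hn : n ≠ 0 := by omega
  refine (((isCounting_core d).comp_pow hn).mul (isCounting_lat d n r hn)).congr fun q h0 h1 => ?_
  have hz0 : q ^ n < q ^ r := pow_lt_pow_right_of_lt_one₀ h0 h1 (by omega)
  have hdiv : q ^ n / q ^ r = q ^ s := by
    rw [← hrs, pow_add, mul_div_cancel_left₀ _ (pow_ne_zero r h0.ne')]
  have h := pair_eq_core_mul_lat (pow_pos h0 n) (pow_lt_one₀ h0.le h1 hn) d hz0
    (pow_lt_one₀ h0.le h1 hr)
  rw [← h, hdiv]
  simp only [etaFactor, ← pow_mul, mul_comm _ (d + 1)]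

theorem prod_range_two_mul (g : ℕ → ℝ) (h : ℕ) :
    ∏ r ∈ Finset.range (2 * h), g r = ∏ r ∈ Finset.range h, (g r * g (2 * h - 1 - r)) := by
  rw [two_mul, Finset.prod_range_add, Finset.prod_mul_distrib]
  congr 1
  rw [← Finset.prod_range_reflect]
  refine Finset.prod_congr rfl fun r hr => ?_
  have := Finset.mem_range.1 hr
  congr 1
  omega

theorem prod_range_two_mul_add_one (g : ℕ → ℝ) (h : ℕ) :
    ∏ r ∈ Finset.range (2 * h + 1), g r =
      (∏ r ∈ Finset.range h, (g r * g (2 * h - r))) * g h := by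
  rw [show 2 * h + 1 = h + 1 + h by ring, Finset.prod_range_add, Finset.prod_range_succ,
    Finset.prod_mul_distrib, mul_right_comm]
  congr 2
  rw [← Finset.prod_range_reflect]
  refine Finset.prod_congr rfl fun r hr => ?_
  have := Finset.mem_range.1 hr
  congr 1
  omega

theorem isCounting_etaQuot_even (d h : ℕ) : IsCounting (etaQuot d (2 * h)) := by
  refine (IsCounting.prod (Finset.range h) (fun r q => etaFactor d (2 * h + 1) (r + 1) q *
    etaFactor d (2 * h + 1) (2 * h - 1 - r + 1) q) fun r hr => ?_).congr fun q _ _ =>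
    prod_range_two_mul (fun r => etaFactor d (2 * h + 1) (r + 1) q) h
  have := Finset.mem_range.1 hr
  exact isCounting_pair d (by omega) (by omega) (by omega)

/-- The modulus is `2(h + 1)`, and the unpaired residue `h + 1` contributes `etaQuot d 1` at
`q^{h+1}`. -/
theorem isCounting_etaQuot_odd (d h : ℕ) (hd : IsCounting (etaQuot d 1)) :
    IsCounting (etaQuot d (2 * h + 1)) := by
  refine ((IsCounting.prod (Finset.range h) (fun r q => etaFactor d (2 * h + 1 + 1) (r + 1) q *
    etaFactor d (2 * h + 1 + 1) (2 * h - r + 1) q) fun r hr => ?_).mul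
    (hd.comp_pow (n := h + 1) (Nat.succ_ne_zero h))).congr fun q _ _ => ?_
  · have := Finset.mem_range.1 hr
    exact isCounting_pair d (by omega) (by omega) (by omega)
  · rw [etaQuot, prod_range_two_mul_add_one (fun r => etaFactor d (2 * h + 1 + 1) (r + 1) q)]
    congr 1
    rw [etaQuot, Finset.prod_range_one]
    simp only [etaFactor, ← pow_mul]
    ring_nf

/-- For `m = n = 2` the quotient is `E(q^2)^2 / E(q)`, the series of 2-cores. -/
theorem isCounting_etaQuot_one_one : IsCounting (etaQuot 1 1) := by
  refine (isCounting_core 1).congr fun q h0 h1 => ?_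
  have h := etaQuot_mul h0 h1 1 1
  have h2 := euler_ne_zero h0 h1
  have h3 := euler_pow_ne_zero h0 h1 (n := (1 + 1) * (1 + 1)) (by norm_num)
  rw [eq_div_iff h2]
  apply mul_right_cancel₀ h3
  linear_combination h

/-- Modulo 2 there is nothing to pair; after exchanging the parameters the residues are taken modulo
`d + 1`. -/
theorem isCounting_etaQuot_one (d : ℕ) : IsCounting (etaQuot d 1) := by
  refine IsCounting.congr (g := etaQuot 1 d) ?_ fun q h0 h1 => etaQuot_comm h0 h1 d 1
  obtain ⟨h, rfl | rfl⟩ := d.even_or_odd'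
  · exact isCounting_etaQuot_even 1 h
  · exact isCounting_etaQuot_odd 1 h isCounting_etaQuot_one_one

theorem isCounting_etaQuot (d k : ℕ) : IsCounting (etaQuot d k) := by
  obtain ⟨h, rfl | rfl⟩ := k.even_or_odd'
  · exact isCounting_etaQuot_even d h
  · exact isCounting_etaQuot_odd d h (isCounting_etaQuot_one d)

theorem isEval_eulerEPow (k : ℕ+) :
    IsEval (eulerEPow k) fun q => qPoch (q ^ (k : ℕ)) (q ^ (k : ℕ)) :=
  isEval_eulerE.expand k.ne_zero

end EtaQuotient

/-- For all positive integers `m` and `n`, the quotient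
`E(q^{mn})^{mn-m-n} E(q^m) E(q^n) / E(q)` has nonnegative coefficients. -/
theorem mainTheorem8 (m n : ℕ+) :
    EtaQuotient.Nonneg
      ((EtaQuotient.E (m * n) ^ ((m : ℤ) * (n : ℤ) - (m : ℤ) - (n : ℤ)) *
        EtaQuotient.E m * EtaQuotient.E n / EtaQuotient.E 1 : ℤ⟦X⟧ˣ) : ℤ⟦X⟧) := by
  open EtaQuotient in
  obtain ⟨d, hd⟩ : ∃ d : ℕ, (m : ℕ) = d + 1 := ⟨m - 1, by have := m.pos; omega⟩
  obtain ⟨k, hk⟩ : ∃ k : ℕ, (n : ℕ) = k + 1 := ⟨n - 1, by have := n.pos; omega⟩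
  refine nonneg_of_isCounting (isCounting_etaQuot d k)
    ((isEval_eulerEPow 1).mul (isEval_eulerEPow (m * n)))
    ((((isEval_eulerEPow (m * n)).pow (d * k)).mul (isEval_eulerEPow m)).mul (isEval_eulerEPow n))
    (fun q h0 h1 => ?_) ?_ ((isUnit_eulerEPow 1).mul (isUnit_eulerEPow (m * n))).ne_zero
  · have := etaQuot_mul h0 h1 d k
    simpa only [PNat.mul_coe, PNat.one_coe, pow_one, hd, hk] using this
  · have h : E (m * n) ^ ((m : ℤ) * (n : ℤ) - (m : ℤ) - (n : ℤ)) * E m * E n / E 1 *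
        (E 1 * E (m * n)) = E (m * n) ^ (d * k) * E m * E n := by
      -- The extra `1` is the factor `E (m * n)` in the denominator, which keeps the exponent a
      -- natural number even when `mn - m - n = -1`.
      have hz : ((d * k : ℕ) : ℤ) = (m : ℤ) * (n : ℤ) - (m : ℤ) - (n : ℤ) + 1 := by
        have h1 : (m : ℤ) = d + 1 := by exact_mod_cast hd
        have h2 : (n : ℤ) = k + 1 := by exact_mod_cast hk
        rw [h1, h2]
        push_cast
        ring
      rw [← zpow_natCast, hz, zpow_add_one, ← mul_assoc, div_mul_cancel]
      ac_rfl
    exact congrArg Units.val h
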